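/- Let $\mathcal F^3$ be the class of all twice continuously differentiable functions $f\colon\mathbb R\to\mathbb R$ such that $f$ and $f''$ are nondecreasing and convex; equivalently, $f, f', f'', f'''$ are nondecreasing, where $f'''$ denotes the right derivative of the convex function $f''$. For $f\in\mathcal F^3$ let $f'''(\infty-):=\lim_{x\to\infty}f'''(x)\in[0,\infty]$. Write $x_+:=\max(0,x)$, let $\beta>0$ be a real constant, and let $Z$ be a standard normal random variable. Let $f\in\mathcal F^3$. Let $X_1,\dots,X_n$ be independent random variables such that $$\mathbb E X_i\le 0\ \text{ for all } i,\qquad \sum_{i=1}^n\mathbb E X_i^2\le 1,\qquad \sum_{i=1}^n\mathbb E (X_i)_+^3\le\beta, \tag{$*$}$$ and let $S:=X_1+\dots+X_n$. Then the expectations $\mathbb E f(S)$ and $\mathbb E f(Z)$ exist in $(-\infty,\infty]$ (that is, the negative parts of $f(S)$ and $f(Z)$ have finite expectations), and $$\mathbb E f(S)\le \mathbb E f(Z)+\frac{f'''(\infty-)}{3!}\,\beta .$$ Moreover, for each $f\in\mathcal F^3$ and each real $\beta>0$ the right-hand side (possibly $\infty$) is exact: it equals the supremum of $\mathbb E f(S)$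 over all $n$ and all independent $X_1,\dots,X_n$ (on arbitrary probability spaces) satisfying $(*)$. -/

import Mathlib

open MeasureTheory ProbabilityTheory Filter Topology

universe u

noncomputable section

/-- The class of twice continuously differentiable functions `f : ℝ → ℝ` such that
`f` and `f''` are nondecreasing and convex. -/
structure ClassF3 (f : ℝ → ℝ) : Prop where
  contDiff : ContDiff ℝ 2 f
  mono : Monotone f
  convex : ConvexOn ℝ Set.univ f
  mono_deriv2 : Monotone (deriv (deriv f))
  convex_deriv2 : ConvexOn ℝ Set.univ (deriv (deriv f))

/-- `f'''`, the right derivative of `f''`. -/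
def thirdDeriv (f : ℝ → ℝ) (x : ℝ) : ℝ :=
  derivWithin (deriv (deriv f)) (Set.Ioi x) x

/-- `f'''(∞-)`, the limit of `f'''` at `∞`, as an extended real number. -/
def thirdDerivInfty (f : ℝ → ℝ) : EReal :=
  limUnder atTop (fun x : ℝ => (thirdDeriv f x : EReal))

/-- On the class above, the limit defining `f'''(∞-)` exists. -/
theorem ClassF3.tendsto_thirdDeriv {f : ℝ → ℝ} (hf : ClassF3 f) :
    Tendsto (fun x : ℝ => (thirdDeriv f x : EReal)) atTop (𝓝 (thirdDerivInfty f)) := by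
  have hm : Monotone (fun x : ℝ => (thirdDeriv f x : EReal)) := by
    intro x y hxy
    exact EReal.coe_le_coe_iff.2
      (hf.convex_deriv2.monotoneOn_rightDeriv (by simp) (by simp) hxy)
  exact tendsto_nhds_limUnder ⟨_, tendsto_atTop_iSup hm⟩

/-- The expectation `E g = E g⁺ - E g⁻` of a measurable function `g`, as an extended real number;
it is meaningful as soon as `E g⁻ < ∞`. -/
def erealExpectation {Ω : Type*} [MeasurableSpace Ω] (P : Measure Ω) (g : Ω → ℝ) : EReal :=
  ((∫⁻ ω, ENNReal.ofReal (g ω) ∂P : ENNReal) : EReal)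
    - ((∫⁻ ω, ENNReal.ofReal (-g ω) ∂P : ENNReal) : EReal)

/-- `X₁, …, Xₙ` are independent random variables with `E Xᵢ ≤ 0` for all `i`, `∑ E Xᵢ² ≤ 1` and
`∑ E (Xᵢ)₊³ ≤ β` (the integrability required for these moments to be finite included). -/
structure MomentConditions {Ω : Type*} [MeasurableSpace Ω] (P : Measure Ω) (β : ℝ) {n : ℕ}
    (X : Fin n → Ω → ℝ) : Prop where
  measurable : ∀ i, Measurable (X i)
  indep : iIndepFun X P
  memLp_two : ∀ i, MemLp (X i) 2 P
  integrable_pos_cube : ∀ i, Integrable (fun ω => max 0 (X i ω) ^ 3) P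
  mean_nonpos : ∀ i, ∫ ω, X i ω ∂P ≤ 0
  sum_sq_le : ∑ i, ∫ ω, X i ω ^ 2 ∂P ≤ 1
  sum_pos_cube_le : ∑ i, ∫ ω, max 0 (X i ω) ^ 3 ∂P ≤ β

/-- All values of `E f(X₁ + ⋯ + Xₙ)`, over all `n`, all probability spaces, and all `X₁, …, Xₙ`
satisfying the moment conditions. -/
def expectationValues (β : ℝ) (f : ℝ → ℝ) : Set EReal :=
  {e | ∃ (n : ℕ) (Ω : Type u) (_ : MeasurableSpace Ω) (P : Measure Ω) (_ : IsProbabilityMeasure P)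
      (X : Fin n → Ω → ℝ), MomentConditions P β X ∧
        e = erealExpectation P (fun ω => f (∑ i, X i ω))}

end

/-!
The upper bound is an exchange argument in the style of Lindeberg. Let `L` be the limit of `f'''` at
infinity, assumed finite; otherwise there is nothing to prove. If `E X ≤ 0` and `E X² ≤ σ²`, then
`E f(y + X) ≤ E f(y + σZ) + L / 6 * E X₊³` for every `y`, because

* `f (y + x) ≤ f y + f' y * x + f'' y * x² / 2 + L / 6 * x₊³`, where `f'''` is at most `L`
  to the right of `y` and `f''` is nondecreasing to the left (`ClassF3.le_taylor`), and
  `f'` and `f''` are nonnegative;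
* `f (y + z) + f (y - z) ≥ 2 * f y + f'' y * z²` by convexity of `f''`
  (`ClassF3.le_symmetrized`), so that `E f(y + σZ) ≥ f y + f'' y * σ² / 2`.

Integrating over `y`, a summand can be exchanged for a Gaussian of the same second moment
(`ClassF3.integral_conv_le`), and induction on the number of summands gives
`ClassF3.integral_sum_le`. Only laws on the line and their convolutions are involved.

For exactness, take `m²` Gaussian summands of total variance `1 - 5β / m`, together with one
independent variable equal to `m` with probability about `β / m³` and to a small negative number
otherwise. The Gaussian part yields `E f(Z)` in the limit, while the large atom contributes at least
`f'''(y) / 6 * β` for each fixed `y`, as `f` grows at least like `f'''(y) / 6 * x³`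
(`le_of_upperBounds_gaussian`). If `f'''` is unbounded, `E f(Z)` may be infinite, and the two-valued
variable alone drives the expectation to infinity (`le_of_upperBounds_single`).
-/

/-! ### Taylor estimates -/

/-- A function with nonnegative second derivative on `[0, ∞)` whose value and derivative at `0`
vanish is nonnegative. -/
theorem nonneg_of_second_deriv_nonneg {g g' g'' : ℝ → ℝ} (h1 : ∀ u, HasDerivAt g (g' u) u)
    (h2 : ∀ u, HasDerivAt g' (g'' u) u) (hpos : ∀ u, 0 ≤ u → 0 ≤ g'' u) (h0 : g 0 = 0)
    (h0' : g' 0 = 0) {u : ℝ} (hu : 0 ≤ u) : 0 ≤ g u := by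
  have key : ∀ {h h' : ℝ → ℝ}, (∀ u, HasDerivAt h (h' u) u) → (∀ u, 0 ≤ u → 0 ≤ h' u) →
      h 0 = 0 → ∀ u, 0 ≤ u → 0 ≤ h u := by
    intro h h' hd hp hz u hu
    have hm : MonotoneOn h (Set.Ici 0) := by
      refine monotoneOn_of_deriv_nonneg (convex_Ici 0)
        (fun x _ => (hd x).continuousAt.continuousWithinAt)
        (fun x _ => (hd x).differentiableAt.differentiableWithinAt) fun x hx => ?_
      rw [interior_Ici] at hx
      rw [(hd x).deriv]
      exact hp x (le_of_lt hx)
    simpa [hz] using hm (Set.mem_Ici.2 le_rfl) (Set.mem_Ici.2 hu) hu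
  exact key h1 (key h2 hpos h0') h0 u hu

namespace ClassF3

variable {f : ℝ → ℝ}

theorem hasDerivAt (hf : ClassF3 f) (x : ℝ) : HasDerivAt f (deriv f x) x :=
  (hf.contDiff.differentiable (by norm_num) x).hasDerivAt

theorem hasDerivAt_deriv (hf : ClassF3 f) (x : ℝ) :
    HasDerivAt (deriv f) (deriv (deriv f) x) x := by
  have h : ContDiff ℝ (1 + 1) f := by simpa [one_add_one_eq_two] using hf.contDiff
  exact ((contDiff_succ_iff_deriv.1 h).2.2.differentiable (by norm_num) x).hasDerivAt

theorem hasDerivAt_add (hf : ClassF3 f) (y u : ℝ) :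
    HasDerivAt (fun u => f (y + u)) (deriv f (y + u)) u :=
  (hf.hasDerivAt (y + u)).comp_const_add y u

theorem hasDerivAt_sub (hf : ClassF3 f) (y u : ℝ) :
    HasDerivAt (fun u => f (y - u)) (-deriv f (y - u)) u :=
  (hf.hasDerivAt (y - u)).comp_const_sub y u

theorem hasDerivAt_deriv_add (hf : ClassF3 f) (y u : ℝ) :
    HasDerivAt (fun u => deriv f (y + u)) (deriv (deriv f) (y + u)) u :=
  (hf.hasDerivAt_deriv (y + u)).comp_const_add y u

theorem hasDerivAt_neg_deriv_sub (hf : ClassF3 f) (y u : ℝ) :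
    HasDerivAt (fun u => -deriv f (y - u)) (deriv (deriv f) (y - u)) u := by
  simpa using ((hf.hasDerivAt_deriv (y - u)).comp_const_sub y u).fun_neg

theorem continuous (hf : ClassF3 f) : Continuous f := hf.contDiff.continuous

theorem deriv_nonneg (hf : ClassF3 f) (x : ℝ) : 0 ≤ deriv f x := hf.mono.deriv_nonneg

theorem deriv2_nonneg (hf : ClassF3 f) (x : ℝ) : 0 ≤ deriv (deriv f) x := by
  have hm : Monotone (deriv f) := fun a b hab =>
    hf.convex.monotoneOn_deriv (fun x _ => (hf.hasDerivAt x).differentiableAt)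
      (Set.mem_univ a) (Set.mem_univ b) hab
  exact hm.deriv_nonneg

theorem deriv2_add_le (hf : ClassF3 f) {L : ℝ} (hL : ∀ x, thirdDeriv f x ≤ L) (y : ℝ) {u : ℝ}
    (hu : 0 ≤ u) : deriv (deriv f) (y + u) ≤ deriv (deriv f) y + L * u := by
  rcases hu.eq_or_lt with rfl | hu
  · simp
  have h1 := hf.convex_deriv2.slope_le_leftDeriv_of_mem_interior (x := y) (y := y + u)
    (Set.mem_univ _) (by simp) (by linarith)
  have h2 := hf.convex_deriv2.leftDeriv_le_rightDeriv_of_mem_interior (x := y + u) (by simp)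
  have h3 := (h1.trans h2).trans (hL (y + u))
  rw [slope_def_field, add_sub_cancel_left, div_le_iff₀ hu] at h3
  linarith

theorem le_deriv2_add (hf : ClassF3 f) (y : ℝ) {u : ℝ} (hu : 0 ≤ u) :
    thirdDeriv f y * u ≤ deriv (deriv f) (y + u) := by
  rcases hu.eq_or_lt with rfl | hu
  · simpa using hf.deriv2_nonneg y
  have h1 := hf.convex_deriv2.rightDeriv_le_slope_of_mem_interior (x := y) (y := y + u)
    (by simp) (Set.mem_univ _) (by linarith)
  change thirdDeriv f y ≤ _ at h1
  rw [slope_def_field, add_sub_cancel_left, le_div_iff₀ hu] at h1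
  linarith [hf.deriv2_nonneg y]

/-- The graph of `f` lies above its tangents. -/
theorem tangent_le (hf : ClassF3 f) (y x : ℝ) : f y + deriv f y * x ≤ f (y + x) := by
  rcases le_total 0 x with hx | hx
  · have := nonneg_of_second_deriv_nonneg (g := fun u => f (y + u) - deriv f y * u - f y)
      (fun u => (((hf.hasDerivAt_add y u).sub
        ((hasDerivAt_id' u).const_mul (deriv f y))).sub_const (f y)))
      (fun u => ((hf.hasDerivAt_deriv_add y u).sub_const (deriv f y * 1)))
      (fun u _ => hf.deriv2_nonneg _) (by simp) (by simp) hx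
    linarith
  · have := nonneg_of_second_deriv_nonneg (g := fun u => f (y - u) + deriv f y * u - f y)
      (fun u => (((hf.hasDerivAt_sub y u).add
        ((hasDerivAt_id' u).const_mul (deriv f y))).sub_const (f y)))
      (fun u => ((hf.hasDerivAt_neg_deriv_sub y u).add_const (deriv f y * 1)))
      (fun u _ => hf.deriv2_nonneg _) (by simp) (by simp) (u := -x) (by linarith)
    simp only [sub_neg_eq_add] at this
    linarith

/-- On the right of `y` the cubic remainder is controlled by `f''' ≤ L`; on the left of `y` it is
nonpositive because `f''` is nondecreasing. -/
theorem le_taylor (hf : ClassF3 f) {L : ℝ} (hL : ∀ x, thirdDeriv f x ≤ L) (y x : ℝ) :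
    f (y + x) ≤ f y + deriv f y * x + deriv (deriv f) y / 2 * x ^ 2 + L / 6 * max 0 x ^ 3 := by
  have hid (u : ℝ) := hasDerivAt_id' u
  rcases le_total 0 x with hx | hx
  · have := nonneg_of_second_deriv_nonneg
      (g := fun u => deriv f y * u + deriv (deriv f) y / 2 * u ^ 2 + L / 6 * u ^ 3
        - f (y + u) + f y)
      (fun u => ((((((hid u).const_mul (deriv f y)).add
        (((hid u).fun_pow 2).const_mul (deriv (deriv f) y / 2))).add
        (((hid u).fun_pow 3).const_mul (L / 6))).sub (hf.hasDerivAt_add y u)).add_const (f y)))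
      (g'' := fun u => deriv (deriv f) y + L * u - deriv (deriv f) (y + u))
      (fun u => by
        have := (((((hid u).const_mul (deriv (deriv f) y)).add
          (((hid u).fun_pow 2).const_mul (L / 2))).sub (hf.hasDerivAt_deriv_add y u)).add_const
            (deriv f y))
        refine (this.congr_deriv ?_).congr_of_eventuallyEq (.of_forall fun t => ?_)
        · simp; ring
        · simp; ring)
      (fun u hu => by linarith [hf.deriv2_add_le hL y hu]) (by simp) (by simp) hx
    rw [max_eq_right hx]
    linarith
  · have := nonneg_of_second_deriv_nonneg
      (g := fun u => -deriv f y * u + deriv (deriv f) y / 2 * u ^ 2 - f (y - u) + f y)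
      (fun u => (((((hid u).const_mul (-deriv f y)).add
        (((hid u).fun_pow 2).const_mul (deriv (deriv f) y / 2))).sub
          (hf.hasDerivAt_sub y u)).add_const (f y)))
      (g'' := fun u => deriv (deriv f) y - deriv (deriv f) (y - u))
      (fun u => by
        have := ((((hid u).const_mul (deriv (deriv f) y)).sub
          (hf.hasDerivAt_neg_deriv_sub y u)).add_const (-deriv f y))
        refine (this.congr_deriv ?_).congr_of_eventuallyEq (.of_forall fun t => ?_)
        · simp
        · simp; ring)
      (fun u hu => by linarith [hf.mono_deriv2 (show y - u ≤ y by linarith)])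
      (by simp) (by simp) (u := -x) (by linarith)
    simp only [sub_neg_eq_add] at this
    rw [max_eq_left hx]
    nlinarith [this]

/-- Convexity of `f''` makes the symmetrized second-order remainder nonnegative. -/
theorem le_symmetrized (hf : ClassF3 f) (y x : ℝ) :
    2 * f y + deriv (deriv f) y * x ^ 2 ≤ f (y + x) + f (y - x) := by
  wlog hx : 0 ≤ x generalizing x
  · have := this (-x) (by linarith)
    simp only [sub_neg_eq_add, ← sub_eq_add_neg, neg_sq] at this
    linarith
  have hid (u : ℝ) := hasDerivAt_id' u
  have := nonneg_of_second_deriv_nonneg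
    (g := fun u => f (y + u) + f (y - u) - deriv (deriv f) y * u ^ 2 - 2 * f y)
    (fun u => ((((hf.hasDerivAt_add y u).add (hf.hasDerivAt_sub y u)).sub
      (((hid u).fun_pow 2).const_mul (deriv (deriv f) y))).sub_const (2 * f y)))
    (g'' := fun u => deriv (deriv f) (y + u) + deriv (deriv f) (y - u) - 2 * deriv (deriv f) y)
    (fun u => by
      have := (((hf.hasDerivAt_deriv_add y u).add (hf.hasDerivAt_neg_deriv_sub y u)).sub
        ((hid u).const_mul (2 * deriv (deriv f) y)))
      refine (this.congr_deriv ?_).congr_of_eventuallyEq (.of_forall fun t => ?_)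
      · simp
      · simp; ring)
    (fun u _ => by
      have := hf.convex_deriv2.2 (Set.mem_univ (y + u)) (Set.mem_univ (y - u))
        (show (0 : ℝ) ≤ 1 / 2 by norm_num) (show (0 : ℝ) ≤ 1 / 2 by norm_num) (by norm_num)
      have e : (1 / 2 : ℝ) • (y + u) + (1 / 2 : ℝ) • (y - u) = y := by simp; ring
      rw [e] at this
      simp only [smul_eq_mul] at this
      linarith)
    (by simp; ring) (by simp) hx
  linarith

theorem cubic_le (hf : ClassF3 f) {l y : ℝ} (hl : l ≤ thirdDeriv f y) {x : ℝ} (hx : 0 ≤ x) :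
    f y + l / 6 * x ^ 3 ≤ f (y + x) := by
  have hid (u : ℝ) := hasDerivAt_id' u
  have := nonneg_of_second_deriv_nonneg
    (g := fun u => f (y + u) - l / 6 * u ^ 3 - deriv f y * u - f y)
    (fun u => ((((hf.hasDerivAt_add y u).sub (((hid u).fun_pow 3).const_mul (l / 6))).sub
      ((hid u).const_mul (deriv f y))).sub_const (f y)))
    (g'' := fun u => deriv (deriv f) (y + u) - l * u)
    (fun u => by
      have := (((hf.hasDerivAt_deriv_add y u).sub
        (((hid u).fun_pow 2).const_mul (l / 2))).sub_const (deriv f y))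
      refine (this.congr_deriv ?_).congr_of_eventuallyEq (.of_forall fun t => ?_)
      · simp; ring
      · simp; ring)
    (fun u hu => by
      have := hf.le_deriv2_add y hu
      nlinarith)
    (by simp) (by simp) hx
  nlinarith [mul_nonneg (hf.deriv_nonneg y) hx]

end ClassF3

/-! ### Laws with finite second moment and finite positive third moment -/

/-- A probability measure on the line with finite second moment and a positive part of finite third
moment. -/
structure HasMoments (μ : Measure ℝ) : Prop where
  isProb : IsProbabilityMeasure μ
  integrable_sq : Integrable (fun x : ℝ => x ^ 2) μ
  integrable_pos_cube : Integrable (fun x : ℝ => max 0 x ^ 3) μ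

namespace HasMoments

variable {μ ν : Measure ℝ}

theorem integrable_id (hμ : HasMoments μ) : Integrable (fun x : ℝ => x) μ := by
  have := hμ.isProb
  refine ((integrable_const (1 : ℝ)).add hμ.integrable_sq).mono' (by fun_prop)
    (.of_forall fun x => ?_)
  rw [Real.norm_eq_abs, Pi.add_apply, ← sq_abs]
  nlinarith [sq_nonneg (|x| - 1), abs_nonneg x]

theorem conv (hμ : HasMoments μ) (hν : HasMoments ν) : HasMoments (μ.conv ν) := by
  have := hμ.isProb
  have := hν.isProb
  refine ⟨inferInstance, ?_, ?_⟩
  · unfold Measure.conv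
    rw [integrable_map_measure (by fun_prop) (by fun_prop)]
    refine (((hμ.integrable_sq.comp_fst ν).const_mul 2).add
      ((hν.integrable_sq.comp_snd μ).const_mul 2)).mono' (by fun_prop) (.of_forall fun z => ?_)
    simp only [Function.comp, Pi.add_apply, Real.norm_eq_abs]
    rw [abs_of_nonneg (by positivity)]
    nlinarith [sq_nonneg (z.1 - z.2)]
  · unfold Measure.conv
    rw [integrable_map_measure (by fun_prop) (by fun_prop)]
    refine (((hμ.integrable_pos_cube.comp_fst ν).const_mul 4).add
      ((hν.integrable_pos_cube.comp_snd μ).const_mul 4)).mono' (by fun_prop)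
      (.of_forall fun z => ?_)
    simp only [Function.comp, Pi.add_apply, Real.norm_eq_abs]
    rw [abs_of_nonneg (by positivity)]
    have h0 : max 0 (z.1 + z.2) ≤ max 0 z.1 + max 0 z.2 :=
      max_le (by positivity) (add_le_add (le_max_right _ _) (le_max_right _ _))
    refine (pow_le_pow_left₀ (le_max_left _ _) h0 3).trans ?_
    have ha := le_max_left 0 z.1
    have hb := le_max_left 0 z.2
    generalize max 0 z.1 = a at *
    generalize max 0 z.2 = b at *
    nlinarith [mul_nonneg (add_nonneg ha hb) (sq_nonneg (a - b))]

theorem of_memLp_three [IsProbabilityMeasure μ] (h : MemLp id 3 μ) : HasMoments μ := by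
  refine ⟨inferInstance, ?_, ?_⟩
  · simpa using (h.mono_exponent (p := 2) (by norm_num)).integrable_sq
  · have h3 := h.integrable_norm_pow (p := 3) (by norm_num)
    refine h3.mono' (by fun_prop) (.of_forall fun x => ?_)
    rw [Real.norm_eq_abs, abs_of_nonneg (by positivity), id, Real.norm_eq_abs]
    exact pow_le_pow_left₀ (le_max_left _ _) (max_le (abs_nonneg _) (le_abs_self _)) 3

theorem gaussianReal (v : NNReal) : HasMoments (gaussianReal 0 v) :=
  of_memLp_three (memLp_id_gaussianReal' 3 (by norm_num))

theorem dirac (a : ℝ) : HasMoments (Measure.dirac a) :=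
  ⟨inferInstance, integrable_dirac (by simp), integrable_dirac (by simp)⟩

end HasMoments

/-! ### Replacing one summand by a Gaussian -/

theorem integral_sq_gaussianReal (v : NNReal) : ∫ x, x ^ 2 ∂(gaussianReal 0 v) = v := by
  have h := variance_fun_id_gaussianReal (μ := 0) (v := v)
  rwa [variance_of_integral_eq_zero (by fun_prop) (by simp)] at h

namespace ClassF3

variable {f : ℝ → ℝ} {L : ℝ} {μ ν : Measure ℝ}

theorem integrable_comp_add (hf : ClassF3 f) (hL : ∀ x, thirdDeriv f x ≤ L) (hμ : HasMoments μ)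
    (y : ℝ) : Integrable (fun x => f (y + x)) μ := by
  have := hμ.isProb
  have hc := hf.continuous
  have hi := (integrable_const (f y)).add (hμ.integrable_id.const_mul (deriv f y))
  have hj := (hi.add (hμ.integrable_sq.const_mul (deriv (deriv f) y / 2))).add
    (hμ.integrable_pos_cube.const_mul (L / 6))
  refine (hi.norm.add hj.norm).mono' (by fun_prop) (.of_forall fun x => ?_)
  simp only [Pi.add_apply, Real.norm_eq_abs]
  refine abs_le.2 ⟨?_, ?_⟩
  · linarith [hf.tangent_le y x, neg_abs_le (f y + deriv f y * x),
      abs_nonneg (f y + deriv f y * x + deriv (deriv f) y / 2 * x ^ 2 + L / 6 * max 0 x ^ 3)]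
  · linarith [hf.le_taylor hL y x, abs_nonneg (f y + deriv f y * x),
      le_abs_self
        (f y + deriv f y * x + deriv (deriv f) y / 2 * x ^ 2 + L / 6 * max 0 x ^ 3)]

theorem integrable (hf : ClassF3 f) (hL : ∀ x, thirdDeriv f x ≤ L) (hμ : HasMoments μ) :
    Integrable f μ := by
  simpa using hf.integrable_comp_add hL hμ 0

/-- By symmetry of the Gaussian law, `E f(y + σZ)` is half the expectation of
`f(y + σZ) + f(y - σZ)`. -/
theorem le_integral_gaussianReal (hf : ClassF3 f) (hL : ∀ x, thirdDeriv f x ≤ L) (y : ℝ)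
    (v : NNReal) :
    f y + deriv (deriv f) y / 2 * v ≤ ∫ z, f (y + z) ∂(ProbabilityTheory.gaussianReal 0 v) := by
  set γ := ProbabilityTheory.gaussianReal 0 v with hγ
  have hc := hf.continuous
  have hint := hf.integrable_comp_add hL (.gaussianReal v) y
  have hneg : γ.map (fun z => -z) = γ := by rw [hγ, gaussianReal_map_neg, neg_zero]
  have hint' : Integrable (fun z => f (y - z)) γ := by
    have h := hint
    rw [← hγ, ← hneg, integrable_map_measure (by fun_prop) (by fun_prop)] at h
    simpa [Function.comp_def, sub_eq_add_neg] using h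
  have heq : ∫ z, f (y - z) ∂γ = ∫ z, f (y + z) ∂γ := by
    conv_rhs => rw [← hneg, integral_map (by fun_prop) (by fun_prop)]
    simp [sub_eq_add_neg]
  have hsq := (HasMoments.gaussianReal v).integrable_sq.const_mul (deriv (deriv f) y)
  have hmono := integral_mono ((integrable_const (2 * f y)).add hsq) (hint.add hint')
    fun x => hf.le_symmetrized y x
  simp only [Pi.add_apply] at hmono
  rw [integral_add (integrable_const _) hsq, integral_add hint hint', ← hγ, heq] at hmono
  simp only [integral_const_mul, integral_const, probReal_univ, one_smul] at hmono
  rw [hγ, integral_sq_gaussianReal] at hmono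
  rw [hγ]
  linarith

theorem integral_comp_add_le (hf : ClassF3 f) (hL : ∀ x, thirdDeriv f x ≤ L) (hμ : HasMoments μ)
    (hmean : ∫ x, x ∂μ ≤ 0) {v : NNReal} (hv : ∫ x, x ^ 2 ∂μ ≤ v) (y : ℝ) :
    ∫ x, f (y + x) ∂μ ≤
      ∫ z, f (y + z) ∂(ProbabilityTheory.gaussianReal 0 v) + L / 6 * ∫ x, max 0 x ^ 3 ∂μ := by
  have := hμ.isProb
  have h1 := hμ.integrable_id.const_mul (deriv f y)
  have h2 := hμ.integrable_sq.const_mul (deriv (deriv f) y / 2)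
  have h3 := hμ.integrable_pos_cube.const_mul (L / 6)
  have hmono := integral_mono (hf.integrable_comp_add hL hμ y)
    ((((integrable_const (f y)).add h1).add h2).add h3) fun x => hf.le_taylor hL y x
  rw [integral_add' (((integrable_const (f y)).add h1).add h2) h3,
    integral_add' ((integrable_const (f y)).add h1) h2,
    integral_add' (integrable_const (f y)) h1] at hmono
  simp only [integral_const_mul, integral_const, probReal_univ, one_smul] at hmono
  have hlin : ∫ x, deriv f y * x ∂μ = deriv f y * ∫ x, x ∂μ := integral_const_mul _ _
  have h4 := mul_nonpos_of_nonneg_of_nonpos (hf.deriv_nonneg y) hmean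
  have h5 := mul_le_mul_of_nonneg_left hv
    (div_nonneg (hf.deriv2_nonneg y) (zero_le_two (α := ℝ)))
  linarith [hf.le_integral_gaussianReal hL y v]

/-- The exchange step: convolving with a law `μ` of nonpositive mean and second moment at most `v`
instead of `N(0, v)` costs at most `L / 6` times the positive third moment of `μ`. -/
theorem integral_conv_le (hf : ClassF3 f) (hL : ∀ x, thirdDeriv f x ≤ L) (hν : HasMoments ν)
    (hμ : HasMoments μ) (hmean : ∫ x, x ∂μ ≤ 0) {v : NNReal} (hv : ∫ x, x ^ 2 ∂μ ≤ v) :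
    ∫ x, f x ∂(ν.conv μ) ≤
      ∫ x, f x ∂(ν.conv (ProbabilityTheory.gaussianReal 0 v))
        + L / 6 * ∫ x, max 0 x ^ 3 ∂μ := by
  have := hμ.isProb
  have := hν.isProb
  have hc := hf.continuous
  have key : ∀ {ρ : Measure ℝ}, HasMoments ρ →
      ∫ x, f x ∂(ν.conv ρ) = ∫ y, ∫ x, f (y + x) ∂ρ ∂ν ∧
        Integrable (fun y => ∫ x, f (y + x) ∂ρ) ν := by
    intro ρ hρ
    have := hρ.isProb
    have hi := hf.integrable hL (hν.conv hρ)
    refine ⟨integral_conv hi, ?_⟩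
    unfold Measure.conv at hi
    rw [integrable_map_measure (by fun_prop) (by fun_prop)] at hi
    exact hi.integral_prod_left
  obtain ⟨e1, i1⟩ := key hμ
  obtain ⟨e2, i2⟩ := key (.gaussianReal v)
  rw [e1, e2]
  have hmono := integral_mono i1 (i2.add (integrable_const (L / 6 * ∫ x, max 0 x ^ 3 ∂μ)))
    fun y => hf.integral_comp_add_le hL hμ hmean hv y
  simp only [Pi.add_apply] at hmono
  rw [integral_add i2 (integrable_const _)] at hmono
  simpa using hmono

theorem integral_gaussianReal_mono (hf : ClassF3 f) (hL : ∀ x, thirdDeriv f x ≤ L) {v w : NNReal}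
    (hvw : v ≤ w) : ∫ x, f x ∂(ProbabilityTheory.gaussianReal 0 v) ≤
      ∫ x, f x ∂(ProbabilityTheory.gaussianReal 0 w) := by
  have := hf.integral_conv_le hL (.gaussianReal v) (.dirac 0) (v := w - v) (by simp) (by simp)
  rw [gaussianReal_conv_gaussianReal, add_tsub_cancel_of_le hvw, Measure.conv_dirac_zero] at this
  simpa using this

end ClassF3

/-! ### Sums of independent random variables -/

section Sums

variable {Ω : Type*} [MeasurableSpace Ω] {P : Measure Ω} [IsProbabilityMeasure P]

theorem map_sum_castSucc {n : ℕ} {X : Fin (n + 1) → Ω → ℝ} (hX : ∀ i, Measurable (X i))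
    (hind : iIndepFun X P) :
    P.map (fun ω => ∑ i, X i ω) =
      (P.map fun ω => ∑ i : Fin n, X i.castSucc ω).conv (P.map (X (Fin.last n))) := by
  have h := hind.indepFun_finsetSum_of_notMem hX
    (s := Finset.univ.map Fin.castSuccEmb) (i := Fin.last n) (by simp)
  have h2 := h.map_add_eq_map_conv_map (by fun_prop) (hX _)
  have e : (∑ j ∈ Finset.univ.map Fin.castSuccEmb, X j) = fun ω => ∑ i : Fin n, X i.castSucc ω := by
    ext ω; simp
  rw [e] at h2
  rw [← h2]
  congr 1
  ext ω
  simp [Fin.sum_univ_castSucc]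

theorem hasMoments_map_sum {n : ℕ} {X : Fin n → Ω → ℝ} (hX : ∀ i, Measurable (X i))
    (hind : iIndepFun X P) (hm : ∀ i, HasMoments (P.map (X i))) :
    HasMoments (P.map fun ω => ∑ i, X i ω) := by
  induction n with
  | zero => simpa using HasMoments.dirac 0
  | succ n ih =>
    rw [map_sum_castSucc hX hind]
    exact (ih (fun i => hX i.castSucc) (hind.precomp (Fin.castSucc_injective n))
      fun i => hm i.castSucc).conv (hm _)

/-- Exchanging the summands one at a time, the Gaussian part of the law absorbs their variances. -/
theorem ClassF3.integral_map_sum_conv_le {f : ℝ → ℝ} (hf : ClassF3 f) {L : ℝ}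
    (hL : ∀ x, thirdDeriv f x ≤ L) {n : ℕ} {X : Fin n → Ω → ℝ} (hX : ∀ i, Measurable (X i))
    (hind : iIndepFun X P) (hm : ∀ i, HasMoments (P.map (X i)))
    (hmean : ∀ i, ∫ ω, X i ω ∂P ≤ 0) (v w : NNReal) (hvw : v + ∑ i, ∫ ω, X i ω ^ 2 ∂P ≤ w) :
    ∫ x, f x ∂((P.map fun ω => ∑ i, X i ω).conv (gaussianReal 0 v)) ≤
      ∫ x, f x ∂(gaussianReal 0 w) + L / 6 * ∑ i, ∫ ω, max 0 (X i ω) ^ 3 ∂P := by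
  induction n generalizing v with
  | zero =>
    simp at hvw
    simpa using hf.integral_gaussianReal_mono hL hvw
  | succ n ih =>
    have hind' := hind.precomp (Fin.castSucc_injective n)
    have hS := hasMoments_map_sum (fun i => hX i.castSucc) hind' fun i => hm i.castSucc
    have := hS.isProb
    have := (hm (Fin.last n)).isProb
    set s : NNReal := ⟨∫ ω, X (Fin.last n) ω ^ 2 ∂P, integral_nonneg fun ω => sq_nonneg _⟩ with hs
    have hmap {g : ℝ → ℝ} (hg : Continuous g) :
        ∫ x, g x ∂(P.map (X (Fin.last n))) = ∫ ω, g (X (Fin.last n) ω) ∂P :=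
      integral_map (hX _).aemeasurable hg.aestronglyMeasurable
    have h1 := hf.integral_conv_le hL (hS.conv (.gaussianReal v)) (hm (Fin.last n)) (v := s)
      (by rw [hmap (by fun_prop)]; exact hmean _) (by rw [hmap (by fun_prop)]; rfl)
    have h2 := ih (fun i => hX i.castSucc) hind' (fun i => hm i.castSucc)
      (fun i => hmean i.castSucc) (v + s) (by
        rw [Fin.sum_univ_castSucc] at hvw
        push_cast
        change _ + (∫ ω, X (Fin.last n) ω ^ 2 ∂P) + _ ≤ _
        linarith)
    rw [Measure.conv_assoc _ _ (gaussianReal 0 s), gaussianReal_conv_gaussianReal, add_zero, hmap (by fun_prop)] at h1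
    rw [map_sum_castSucc hX hind, Measure.conv_assoc, Measure.conv_comm (P.map (X (Fin.last n))),
      ← Measure.conv_assoc, Fin.sum_univ_castSucc, mul_add]
    linarith

theorem MomentConditions.hasMoments {β : ℝ} {n : ℕ} {X : Fin n → Ω → ℝ}
    (h : MomentConditions P β X) (i : Fin n) : HasMoments (P.map (X i)) := by
  have hi := (h.measurable i).aemeasurable (μ := P)
  refine ⟨Measure.isProbabilityMeasure_map hi, ?_, ?_⟩
  · rw [integrable_map_measure (by fun_prop) hi]
    exact (h.memLp_two i).integrable_sq
  · rw [integrable_map_measure (by fun_prop) hi]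
    exact h.integrable_pos_cube i

/-- The upper bound, for `f'''` bounded by `L`. -/
theorem ClassF3.integral_sum_le {f : ℝ → ℝ} (hf : ClassF3 f) {L : ℝ} (hL0 : 0 ≤ L)
    (hL : ∀ x, thirdDeriv f x ≤ L) {β : ℝ} {n : ℕ} {X : Fin n → Ω → ℝ}
    (h : MomentConditions P β X) :
    Integrable (fun ω => f (∑ i, X i ω)) P ∧
    ∫ ω, f (∑ i, X i ω) ∂P ≤ ∫ x, f x ∂(gaussianReal 0 1) + L / 6 * β := by
  have hc := hf.continuous
  have hX := h.measurable
  have hS := hasMoments_map_sum h.measurable h.indep h.hasMoments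
  have hle := hf.integral_map_sum_conv_le hL h.measurable h.indep h.hasMoments h.mean_nonpos 0 1
    (by simpa using h.sum_sq_le)
  rw [gaussianReal_zero_var, Measure.conv_dirac_zero,
    integral_map (by fun_prop) (by fun_prop)] at hle
  constructor
  · have hi := hf.integrable hL hS
    rwa [integrable_map_measure (by fun_prop) (by fun_prop)] at hi
  · exact hle.trans (by gcongr; exact h.sum_pos_cube_le)

end Sums

/-! ### Realizing prescribed laws -/

/-- Independent random variables with prescribed laws, on a probability space in any universe. -/
theorem exists_iIndepFun_map_eq {n : ℕ} (μ : Fin n → Measure ℝ)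
    (hp : ∀ i, IsProbabilityMeasure (μ i)) :
    ∃ (Ω : Type u) (_ : MeasurableSpace Ω) (P : Measure Ω) (_ : IsProbabilityMeasure P)
      (X : Fin n → Ω → ℝ), (∀ i, Measurable (X i)) ∧ iIndepFun X P ∧ ∀ i, P.map (X i) = μ i := by
  obtain ⟨Ω, mΩ, P, Y, hY, hlaw, hind, hP⟩ := exists_hasLaw_indepFun
    (fun _ : Fin n => ULift.{u} ℝ) fun i => (μ i).map ULift.up
  refine ⟨Ω, mΩ, P, hP, fun i => ULift.down ∘ Y i, fun i => measurable_down.comp (hY i),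
    hind.comp (fun _ => ULift.down) fun _ => measurable_down, fun i => ?_⟩
  rw [← Measure.map_map measurable_down (hY i), (hlaw i).map_eq,
    Measure.map_map measurable_down measurable_up]
  exact Measure.map_id

theorem exists_momentConditions {β : ℝ} {n : ℕ} (μ : Fin n → Measure ℝ)
    (hm : ∀ i, HasMoments (μ i)) (hmean : ∀ i, ∫ x, x ∂(μ i) ≤ 0)
    (hsq : ∑ i, ∫ x, x ^ 2 ∂(μ i) ≤ 1) (hcube : ∑ i, ∫ x, max 0 x ^ 3 ∂(μ i) ≤ β) :
    ∃ (Ω : Type u) (_ : MeasurableSpace Ω) (P : Measure Ω) (_ : IsProbabilityMeasure P)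
      (X : Fin n → Ω → ℝ), MomentConditions P β X ∧ ∀ i, P.map (X i) = μ i := by
  obtain ⟨Ω, mΩ, P, hP, X, hX, hind, hmap⟩ :=
    exists_iIndepFun_map_eq.{u} μ fun i => (hm i).isProb
  have hint (i : Fin n) {g : ℝ → ℝ} (hg : Continuous g) :
      ∫ ω, g (X i ω) ∂P = ∫ x, g x ∂(μ i) := by
    rw [← hmap i, integral_map (hX i).aemeasurable hg.aestronglyMeasurable]
  have hi (i : Fin n) {g : ℝ → ℝ} (hg : Continuous g) (h : Integrable g (μ i)) :
      Integrable (fun ω => g (X i ω)) P := by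
    rwa [← hmap i, integrable_map_measure hg.aestronglyMeasurable (hX i).aemeasurable] at h
  refine ⟨Ω, mΩ, P, hP, X, ⟨hX, hind, fun i => ?_, fun i => ?_, fun i => ?_, ?_, ?_⟩, hmap⟩
  · rw [memLp_two_iff_integrable_sq (hX i).aestronglyMeasurable]
    exact hi i (g := fun x => x ^ 2) (by fun_prop) (hm i).integrable_sq
  · exact hi i (g := fun x => max 0 x ^ 3) (by fun_prop) (hm i).integrable_pos_cube
  · exact (hint i continuous_id).trans_le (hmean i)
  · refine le_of_eq_of_le (Finset.sum_congr rfl fun i _ => ?_) hsq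
    exact hint i (g := fun x => x ^ 2) (by fun_prop)
  · refine le_of_eq_of_le (Finset.sum_congr rfl fun i _ => ?_) hcube
    exact hint i (g := fun x => max 0 x ^ 3) (by fun_prop)

theorem map_sum_gaussianReal {Ω : Type*} [MeasurableSpace Ω] {P : Measure Ω}
    [IsProbabilityMeasure P] {n : ℕ} {X : Fin n → Ω → ℝ} (hX : ∀ i, Measurable (X i))
    (hind : iIndepFun X P) {v : NNReal} (hlaw : ∀ i, P.map (X i) = gaussianReal 0 v) :
    P.map (fun ω => ∑ i, X i ω) = gaussianReal 0 (n * v) := by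
  induction n with
  | zero => simp
  | succ n ih =>
    rw [map_sum_castSucc hX hind, ih (fun i => hX i.castSucc)
      (hind.precomp (Fin.castSucc_injective n)) fun i => hlaw i.castSucc, hlaw,
      gaussianReal_conv_gaussianReal]
    congr 1
    · simp
    · push_cast; ring

/-- The law with an atom of mass `p` at `x` and the remaining mass at `-2px`. For `p ≤ 1/2` and
`0 ≤ x` its mean is nonpositive. -/
noncomputable def twoPoint (p x : ℝ) : Measure ℝ :=
  ENNReal.ofReal (1 - p) • Measure.dirac (-(2 * p * x)) + ENNReal.ofReal p • Measure.dirac x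

theorem integrable_twoPoint (p x : ℝ) (g : ℝ → ℝ) : Integrable g (twoPoint p x) :=
  ((integrable_dirac (by simp)).smul_measure (by simp)).add_measure
    ((integrable_dirac (by simp)).smul_measure (by simp))

theorem integral_twoPoint {p : ℝ} (hp0 : 0 ≤ p) (hp1 : p ≤ 1) (x : ℝ) (g : ℝ → ℝ) :
    ∫ y, g y ∂(twoPoint p x) = (1 - p) * g (-(2 * p * x)) + p * g x := by
  unfold twoPoint
  rw [integral_add_measure ((integrable_dirac (by simp)).smul_measure (by simp))
    ((integrable_dirac (by simp)).smul_measure (by simp)), integral_smul_measure,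
    integral_smul_measure, integral_dirac, integral_dirac,
    ENNReal.toReal_ofReal (by linarith), ENNReal.toReal_ofReal hp0]
  rfl

theorem HasMoments.twoPoint {p : ℝ} (hp0 : 0 ≤ p) (hp1 : p ≤ 1) (x : ℝ) :
    HasMoments (twoPoint p x) := by
  refine ⟨⟨?_⟩, integrable_twoPoint _ _ _, integrable_twoPoint _ _ _⟩
  simp [_root_.twoPoint, ← ENNReal.ofReal_add (sub_nonneg.2 hp1) hp0]

theorem erealExpectation_eq_integral {Ω : Type*} [MeasurableSpace Ω] {P : Measure Ω} {g : Ω → ℝ}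
    (hg : Integrable g P) : erealExpectation P g = ((∫ ω, g ω ∂P : ℝ) : EReal) := by
  have h (g : Ω → ℝ) (hg : Integrable g P) :
      ((∫⁻ ω, ENNReal.ofReal (g ω) ∂P : ENNReal) : EReal) =
        ((∫⁻ ω, ENNReal.ofReal (g ω) ∂P).toReal : EReal) := by
    rw [← EReal.toReal_coe_ennreal, EReal.coe_toReal]
    · simpa using hg.lintegral_lt_top.ne
    · simp
  rw [integral_eq_lintegral_pos_part_sub_lintegral_neg_part hg, EReal.coe_sub, ← h g hg,
    ← h (fun ω => -g ω) hg.neg]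
  rfl

/-! ### Near-extremal sums -/

/-- The near-extremal sum: `n` summands with law `N(0, v)` and one with a two-point law, whose second
moment is `p * x ^ 2 + (1 - p) * (2 * p * x) ^ 2 ≤ 5 * p * x ^ 2`. The bound keeps only the value
`f x` of the part of the expectation carried by the atom at `x`. -/
theorem exists_mem_expectationValues {β : ℝ} {f : ℝ → ℝ} (hf : ClassF3 f) (n : ℕ) (v : NNReal)
    (hint : ∀ y, Integrable (fun z => f (y + z)) (gaussianReal 0 (n * v)))
    {p x : ℝ} (hp0 : 0 ≤ p) (hp1 : p ≤ 1 / 2) (hx : 0 ≤ x)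
    (hsq : n * v + 5 * p * x ^ 2 ≤ 1)
    (hcube : n * ∫ z, max 0 z ^ 3 ∂(gaussianReal 0 v) + p * x ^ 3 ≤ β) :
    ∃ e ∈ expectationValues.{u} β f,
      (((1 - p) * ∫ z, f (-(2 * p * x) + z) ∂(gaussianReal 0 (n * v)) + p * f x : ℝ) : EReal)
        ≤ e := by
  have hτ := HasMoments.twoPoint hp0 (by linarith : p ≤ 1) x
  have hτi := integral_twoPoint hp0 (by linarith : p ≤ 1) x
  have hpx : 0 ≤ p * x := mul_nonneg hp0 hx
  set μ : Fin (n + 1) → Measure ℝ :=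
    Fin.snoc (α := fun _ => Measure ℝ) (fun _ => gaussianReal 0 v) (twoPoint p x) with hμ
  have hμc (i : Fin n) : μ i.castSucc = gaussianReal 0 v := by simp [hμ]
  have hμl : μ (Fin.last n) = twoPoint p x := by simp [hμ]
  obtain ⟨Ω, _, P, _, X, hX, hlaw⟩ := exists_momentConditions.{u} (β := β) μ
    (Fin.lastCases (by rwa [hμl]) fun i => by rw [hμc]; exact .gaussianReal v)
    (Fin.lastCases (by
      rw [hμl, hτi]
      nlinarith) fun i => by rw [hμc]; simp)
    (by
      rw [Fin.sum_univ_castSucc, hμl, hτi]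
      simp only [hμc, integral_sq_gaussianReal]
      simp only [Finset.sum_const, Finset.card_univ, Fintype.card_fin, nsmul_eq_mul]
      nlinarith [mul_nonneg hp0 (sq_nonneg x), mul_nonneg hp0 (sq_nonneg (p * x))])
    (by
      rw [Fin.sum_univ_castSucc, hμl, hτi, max_eq_left (by linarith), max_eq_right hx]
      simp only [hμc]
      simpa using hcube)
  have hXm := hX.measurable
  have hc := hf.continuous
  have hsum : P.map (fun ω => ∑ i, X i ω) = (twoPoint p x).conv (gaussianReal 0 (n * v)) := by
    have := hτ.isProb
    rw [map_sum_castSucc hX.measurable hX.indep, map_sum_gaussianReal (fun i => hXm i.castSucc)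
      (hX.indep.precomp (Fin.castSucc_injective n)) (fun i => (hlaw _).trans (hμc i)), hlaw, hμl,
      Measure.conv_comm]
  have := hτ.isProb
  have hconv : Integrable f ((twoPoint p x).conv (gaussianReal 0 (n * v))) :=
    (integrable_conv_iff hc.aestronglyMeasurable).2
      ⟨.of_forall hint, integrable_twoPoint _ _ _⟩
  have hSi : Integrable (fun ω => f (∑ i, X i ω)) P := by
    have h := hconv
    rwa [← hsum, integrable_map_measure (by fun_prop) (by fun_prop)] at h
  refine ⟨_, ⟨n + 1, Ω, ‹_›, P, ‹_›, X, hX, rfl⟩, ?_⟩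
  rw [erealExpectation_eq_integral hSi]
  have hval : ∫ ω, f (∑ i, X i ω) ∂P = ∫ s, f s ∂(P.map fun ω => ∑ i, X i ω) := by
    rw [integral_map (by fun_prop) (by fun_prop)]
  rw [hval, hsum, integral_conv hconv, hτi]
  -- Jensen's inequality, through the tangent of `f` at `x`
  have hjensen : f x ≤ ∫ z, f (x + z) ∂(gaussianReal 0 (n * v)) := by
    have hi := (HasMoments.gaussianReal (n * v)).integrable_id.const_mul (deriv f x)
    have h := integral_mono ((integrable_const (f x)).add hi) (hint x) fun z => hf.tangent_le x z
    rw [integral_add' (integrable_const _) hi, integral_const_mul (deriv f x) fun z : ℝ => z] at h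
    simpa using h
  exact_mod_cast add_le_add_right (mul_le_mul_of_nonneg_left hjensen hp0) _

/-- A bound on the near-extremal expectations passes to the limit as the large atom, located at `m`
with mass about `β / m ^ 3`, moves to infinity. -/
theorem limit_le_of_eventually_le {f : ℝ → ℝ} (hf : ClassF3 f) {β I : ℝ} {b J : ℕ → ℝ}
    (hb0 : ∀ᶠ m in atTop, 0 ≤ b m) (hb : Tendsto b atTop (𝓝 β)) (hJ : Tendsto J atTop (𝓝 I))
    {c : EReal}
    (hc : ∀ᶠ m : ℕ in atTop, (((1 - b m / m ^ 3) * J m + b m / m ^ 3 * f m : ℝ) : EReal) ≤ c)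
    (y : ℝ) : ((I + thirdDeriv f y / 6 * β : ℝ) : EReal) ≤ c := by
  set l := thirdDeriv f y
  have hinv := tendsto_inv_atTop_nhds_zero_nat (𝕜 := ℝ)
  have hlim : Tendsto (fun m : ℕ => (1 - b m * ((m : ℝ)⁻¹) ^ 3) * J m + b m * ((m : ℝ)⁻¹) ^ 3 * f y
      + l / 6 * (b m * (1 - y * (m : ℝ)⁻¹) ^ 3)) atTop (𝓝 (I + l / 6 * β)) := by
    have h3 := hb.mul (hinv.pow 3)
    have h := (((tendsto_const_nhds (x := (1 : ℝ))).sub h3).mul hJ).add (h3.mul_const (f y))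
    have h' := (hb.mul (((tendsto_const_nhds (x := (1 : ℝ))).sub (hinv.const_mul y)).pow 3)).const_mul
      (l / 6)
    simpa using h.add h'
  refine le_of_tendsto (EReal.tendsto_coe.2 hlim) ?_
  filter_upwards [hc, hb0, eventually_ge_atTop ⌈y⌉₊, eventually_gt_atTop 0] with m hm hbm hmy hm0
  refine le_trans (EReal.coe_le_coe_iff.2 ?_) hm
  have hmy' : y ≤ m := Nat.ceil_le.1 hmy
  have hm0' : (0 : ℝ) < m := by exact_mod_cast hm0
  have hcub := hf.cubic_le (le_refl l) (sub_nonneg.2 hmy')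
  rw [add_sub_cancel] at hcub
  have hmul := mul_le_mul_of_nonneg_left hcub (div_nonneg hbm (pow_pos hm0' 3).le)
  have e : b m / m ^ 3 * (f y + l / 6 * (m - y) ^ 3) =
      b m * ((m : ℝ)⁻¹) ^ 3 * f y + l / 6 * (b m * (1 - y * (m : ℝ)⁻¹) ^ 3) := by
    field_simp
  have hdiv : b m / (m : ℝ) ^ 3 = b m * ((m : ℝ)⁻¹) ^ 3 := by rw [div_eq_mul_inv, inv_pow]
  rw [e] at hmul
  rw [hdiv] at hmul ⊢
  linarith

theorem eventually_mass_le_half {β : ℝ} {b : ℕ → ℝ} (hb : Tendsto b atTop (𝓝 β)) :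
    ∀ᶠ m : ℕ in atTop, b m / m ^ 3 ≤ 1 / 2 := by
  have h := hb.mul ((tendsto_inv_atTop_nhds_zero_nat (𝕜 := ℝ)).pow 3)
  simp only [ne_eq, OfNat.ofNat_ne_zero, not_false_eq_true, zero_pow, mul_zero] at h
  filter_upwards [h.eventually (ge_mem_nhds (show (0 : ℝ) < 1 / 2 by norm_num))] with m hm
  rwa [div_eq_mul_inv, ← inv_pow]

/-- Using a single summand with a two-point law. -/
theorem le_of_upperBounds_single {β : ℝ} (hβ : 0 < β) {f : ℝ → ℝ} (hf : ClassF3 f) {c : EReal}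
    (hc : c ∈ upperBounds (expectationValues.{u} β f)) (y : ℝ) :
    ((f 0 + thirdDeriv f y / 6 * β : ℝ) : EReal) ≤ c := by
  have hinv := tendsto_inv_atTop_nhds_zero_nat (𝕜 := ℝ)
  refine limit_le_of_eventually_le hf (b := fun _ => β)
    (J := fun m => f (-(2 * β * ((m : ℝ)⁻¹) ^ 2)))
    (.of_forall fun _ => hβ.le) tendsto_const_nhds ?_ ?_ y
  · have h := ((hinv.pow 2).const_mul (2 * β)).neg
    exact (hf.continuous.tendsto _).comp (by simpa using h)
  · have h5 := hinv.const_mul (5 * β)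
    rw [mul_zero] at h5
    filter_upwards [eventually_mass_le_half (tendsto_const_nhds (x := β)),
      h5.eventually (ge_mem_nhds one_pos), eventually_gt_atTop 0] with m hm h5m hm0
    have hm0' : (0 : ℝ) < m := by exact_mod_cast hm0
    obtain ⟨e, he, hle⟩ := exists_mem_expectationValues.{u} (β := β) hf 0 0
      (by simp [integrable_dirac]) (p := β / m ^ 3) (x := m) (by positivity) hm hm0'.le
      (by
        have : 5 * (β / m ^ 3) * m ^ 2 = 5 * β * (m : ℝ)⁻¹ := by field_simp
        simpa [this] using h5m)
      (by
        have : β / m ^ 3 * m ^ 3 = β := by field_simp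
        simp [this])
    refine le_trans (le_of_eq ?_) (hle.trans (hc he))
    have : 2 * (β / m ^ 3) * m = 2 * β * ((m : ℝ)⁻¹) ^ 2 := by field_simp
    simp [this]

theorem gaussianReal_sq_eq_map (s : NNReal) :
    gaussianReal 0 (s ^ 2) = (gaussianReal 0 1).map (fun z : ℝ => s * z) := by
  rw [gaussianReal_map_const_mul]
  congr 1
  · simp
  · ext; simp

theorem integral_gaussianReal_sq (s : NNReal) {g : ℝ → ℝ} (hg : Continuous g) :
    ∫ z, g z ∂(gaussianReal 0 (s ^ 2)) = ∫ z, g (s * z) ∂(gaussianReal 0 1) := by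
  rw [gaussianReal_sq_eq_map, integral_map (by fun_prop) hg.aestronglyMeasurable]

/-- By monotonicity, `f(δ + sz)` with `|δ| ≤ 1` and `0 ≤ s ≤ 1` lies between `f(-1 - |z|)` and
`f(1 + |z|)`, which are Gaussian-integrable. -/
theorem ClassF3.tendsto_integral_gaussianReal {f : ℝ → ℝ} (hf : ClassF3 f) {L : ℝ}
    (hL : ∀ x, thirdDeriv f x ≤ L) {d s : ℕ → ℝ} (hd : Tendsto d atTop (𝓝 0))
    (hs : Tendsto s atTop (𝓝 1)) (hs0 : ∀ m, 0 ≤ s m) (hs1 : ∀ m, s m ≤ 1) :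
    Tendsto (fun m => ∫ z, f (d m + s m * z) ∂(gaussianReal 0 1)) atTop
      (𝓝 (∫ z, f z ∂(gaussianReal 0 1))) := by
  have hc := hf.continuous
  have h1 := (hf.integrable_comp_add hL (.gaussianReal 1) 1).norm
  have h2 := (hf.integrable_comp_add hL (.gaussianReal 1) (-1)).norm
  have hrefl : Measure.map (fun z => -z) (gaussianReal 0 1) = gaussianReal 0 1 := by
    rw [gaussianReal_map_neg, neg_zero]
  have hflip {g : ℝ → ℝ} (hg : Continuous g) (h : Integrable g (gaussianReal 0 1)) :
      Integrable (fun z => g (-z)) (gaussianReal 0 1) := by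
    rwa [← hrefl, integrable_map_measure hg.aestronglyMeasurable (by fun_prop)] at h
  refine tendsto_integral_filter_of_dominated_convergence
    (fun z => (|f (1 + z)| + |f (1 + -z)|) + (|f (-1 + z)| + |f (-1 + -z)|))
    (.of_forall fun m => by fun_prop) ?_
    ((h1.add (hflip (by fun_prop) h1)).add (h2.add (hflip (by fun_prop) h2))) ?_
  · filter_upwards [hd.eventually (Icc_mem_nhds (by norm_num : (-1 : ℝ) < 0) one_pos)] with m hm
    refine .of_forall fun z => ?_
    have hsz : |s m * z| ≤ |z| := by
      rw [abs_mul, abs_of_nonneg (hs0 m)]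
      exact mul_le_of_le_one_left (abs_nonneg _) (hs1 m)
    have hsz' := abs_le.1 hsz
    have hu : f (d m + s m * z) ≤ |f (1 + |z|)| :=
      (hf.mono (by linarith [hm.2])).trans (le_abs_self _)
    have hl : -|f (-1 + -|z|)| ≤ f (d m + s m * z) :=
      (neg_abs_le _).trans (hf.mono (by linarith [hm.1]))
    rw [Real.norm_eq_abs]
    refine abs_le.2 ?_
    rcases abs_cases z with ⟨hz, _⟩ | ⟨hz, _⟩ <;> rw [hz] at hu hl
    · constructor <;> linarith [abs_nonneg (f (1 + z)), abs_nonneg (f (1 + -z)),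
        abs_nonneg (f (-1 + z)), abs_nonneg (f (-1 + -z))]
    · rw [neg_neg] at hl
      constructor <;> linarith [abs_nonneg (f (1 + z)), abs_nonneg (f (1 + -z)),
        abs_nonneg (f (-1 + z)), abs_nonneg (f (-1 + -z))]
  · refine .of_forall fun z => (hc.tendsto _).comp ?_
    simpa using hd.add (hs.mul_const z)

/-- Using `m ^ 2` Gaussian summands of total variance `1 - 5β / m`, whose positive third moments
sum up to at most a constant multiple of `1 / m`, and one summand with a two-point law. -/
theorem le_of_upperBounds_gaussian {β : ℝ} (hβ : 0 < β) {f : ℝ → ℝ} (hf : ClassF3 f) {L : ℝ}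
    (hL : ∀ x, thirdDeriv f x ≤ L) {c : EReal}
    (hc : c ∈ upperBounds (expectationValues.{u} β f)) (y : ℝ) :
    ((∫ z, f z ∂(gaussianReal 0 1) + thirdDeriv f y / 6 * β : ℝ) : EReal) ≤ c := by
  have hinv := tendsto_inv_atTop_nhds_zero_nat (𝕜 := ℝ)
  have hcont := hf.continuous
  set C := ∫ z, max 0 z ^ 3 ∂(gaussianReal 0 1) with hC
  have hC0 : 0 ≤ C := integral_nonneg fun z => by positivity
  set b : ℕ → ℝ := fun m => β - C * (m : ℝ)⁻¹ with hbdef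
  have hb : Tendsto b atTop (𝓝 β) := by
    simpa using (tendsto_const_nhds (x := β)).sub (hinv.const_mul C)
  have hb0 : ∀ᶠ m in atTop, 0 ≤ b m := hb.eventually (le_mem_nhds hβ)
  set s : ℕ → NNReal := fun m => NNReal.sqrt (Real.toNNReal (1 - 5 * β * (m : ℝ)⁻¹)) with hsdef
  have hs1 (m : ℕ) : s m ≤ 1 := by
    rw [hsdef, NNReal.sqrt_le_one, Real.toNNReal_le_one]
    have : (0 : ℝ) ≤ 5 * β * (m : ℝ)⁻¹ := by positivity
    linarith
  have hs : Tendsto s atTop (𝓝 1) := by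
    have h := (tendsto_const_nhds (x := (1 : ℝ))).sub (hinv.const_mul (5 * β))
    rw [mul_zero, sub_zero] at h
    simpa [hsdef, Function.comp_def] using
      (NNReal.continuous_sqrt.tendsto _).comp (tendsto_real_toNNReal h)
  refine limit_le_of_eventually_le hf
    (J := fun m => ∫ z, f (-(2 * b m * ((m : ℝ)⁻¹) ^ 2) + s m * z) ∂(gaussianReal 0 1))
    hb0 hb ?_ ?_ y
  · refine hf.tendsto_integral_gaussianReal hL ?_ (s := fun m => (s m : ℝ))
      (NNReal.tendsto_coe.2 hs) (fun m => (s m).2) fun m => by exact_mod_cast hs1 m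
    simpa using ((hb.const_mul 2).mul (hinv.pow 2)).neg
  · have h5 := hinv.const_mul (5 * β)
    rw [mul_zero] at h5
    filter_upwards [hb0, eventually_mass_le_half hb, h5.eventually (ge_mem_nhds one_pos),
      eventually_gt_atTop 0] with m hbm hm h5m hm0
    have hm0' : (0 : ℝ) < m := by exact_mod_cast hm0
    have hm0n : (m : NNReal) ≠ 0 := by exact_mod_cast hm0.ne'
    have hv : ((m ^ 2 : ℕ) : NNReal) * (s m / m) ^ 2 = s m ^ 2 := by
      push_cast
      field_simp
    have hsm : ((s m : ℝ)) ^ 2 = 1 - 5 * β * (m : ℝ)⁻¹ := by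
      rw [← NNReal.coe_pow, hsdef, NNReal.sq_sqrt, Real.coe_toNNReal _ (by linarith)]
    obtain ⟨e, he, hle⟩ := exists_mem_expectationValues.{u} (β := β) hf (m ^ 2) ((s m / m) ^ 2)
      (fun y => hf.integrable_comp_add hL (.gaussianReal _) y)
      (p := b m / m ^ 3) (x := m) (by positivity) hm hm0'.le
      (by
        rw [← NNReal.coe_natCast (m ^ 2), ← NNReal.coe_mul, hv, NNReal.coe_pow, hsm]
        have e1 : 5 * (b m / m ^ 3) * m ^ 2 = 5 * b m * (m : ℝ)⁻¹ := by field_simp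
        have e2 : b m ≤ β := by
          have : 0 ≤ C * (m : ℝ)⁻¹ := by positivity
          simp only [hbdef]
          linarith
        have e3 := mul_le_mul_of_nonneg_right e2 (inv_nonneg.2 hm0'.le)
        rw [e1]
        linarith)
      (by
        have e1 : b m / m ^ 3 * m ^ 3 = b m := by field_simp
        rw [e1, integral_gaussianReal_sq _ (by fun_prop)]
        have e2 : ∀ z : ℝ, max 0 (((s m / m : NNReal) : ℝ) * z) ^ 3 =
            ((s m / m : NNReal) : ℝ) ^ 3 * max 0 z ^ 3 := by
          intro z
          rw [← mul_pow, mul_max_of_nonneg _ _ (NNReal.coe_nonneg _), mul_zero]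
        simp only [e2]
        rw [integral_const_mul, ← hC]
        push_cast
        have e3 : (m : ℝ) ^ 2 * ((s m / m) ^ 3 * C) = (s m : ℝ) ^ 3 * (C * (m : ℝ)⁻¹) := by
          field_simp
        have e4 : (s m : ℝ) ^ 3 ≤ 1 := pow_le_one₀ (s m).2 (by exact_mod_cast hs1 m)
        have e5 := mul_le_mul_of_nonneg_right e4 (show 0 ≤ C * (m : ℝ)⁻¹ by positivity)
        rw [e3]
        simp only [hbdef]
        linarith)
    refine le_trans (le_of_eq ?_) (hle.trans (hc he))
    have e1 : 2 * (b m / m ^ 3) * m = 2 * b m * ((m : ℝ)⁻¹) ^ 2 := by field_simp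
    rw [hv, integral_gaussianReal_sq _ (by fun_prop), e1]

/-! ### The limit of the third derivative -/

theorem ClassF3.monotone_thirdDeriv {f : ℝ → ℝ} (hf : ClassF3 f) : Monotone (thirdDeriv f) :=
  fun _ _ hxy => hf.convex_deriv2.monotoneOn_rightDeriv (by simp) (by simp) hxy

theorem ClassF3.thirdDeriv_nonneg {f : ℝ → ℝ} (hf : ClassF3 f) (x : ℝ) : 0 ≤ thirdDeriv f x :=
  (hf.mono_deriv2.monotoneOn _).derivWithin_nonneg

theorem ClassF3.thirdDerivInfty_nonneg {f : ℝ → ℝ} (hf : ClassF3 f) : 0 ≤ thirdDerivInfty f :=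
  ge_of_tendsto' hf.tendsto_thirdDeriv fun x => EReal.coe_nonneg.2 (hf.thirdDeriv_nonneg x)

/-- The negative part of `f(S)` is integrable whenever `S` is, as `f` has an affine minorant. -/
theorem ClassF3.lintegral_neg_lt_top {f : ℝ → ℝ} (hf : ClassF3 f) {Ω : Type*} [MeasurableSpace Ω]
    {P : Measure Ω} [IsFiniteMeasure P] {S : Ω → ℝ} (hS : Integrable S P) :
    ∫⁻ ω, ENNReal.ofReal (-f (S ω)) ∂P < ⊤ := by
  have hi : Integrable (fun ω => -(f 0 + deriv f 0 * S ω)) P :=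
    ((integrable_const (f 0)).add (hS.const_mul (deriv f 0))).neg
  refine lt_of_le_of_lt (lintegral_mono fun ω => ENNReal.ofReal_le_ofReal ?_) hi.lintegral_lt_top
  have := hf.tangent_le 0 (S ω)
  rw [zero_add] at this
  linarith

theorem erealExpectation_ne_bot {Ω : Type*} [MeasurableSpace Ω] {P : Measure Ω} {g : Ω → ℝ}
    (hg : ∫⁻ ω, ENNReal.ofReal (-g ω) ∂P < ⊤) : erealExpectation P g ≠ ⊥ := by
  unfold erealExpectation
  rw [sub_eq_add_neg, EReal.add_ne_bot_iff]
  exact ⟨EReal.coe_ennreal_ne_bot _, by simpa [EReal.neg_eq_bot_iff] using hg.ne⟩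

theorem theorem1 (β : ℝ) (hβ : 0 < β) (f : ℝ → ℝ) (hf : ClassF3 f) :
    -- the negative part of `f(Z)` has a finite expectation, `Z` being standard normal
    (∫⁻ z, ENNReal.ofReal (-f z) ∂(gaussianReal 0 1) < ⊤) ∧
    (∀ (n : ℕ) (Ω : Type u) [MeasurableSpace Ω] (P : Measure Ω) [IsProbabilityMeasure P]
        (X : Fin n → Ω → ℝ), MomentConditions P β X →
      -- the negative part of `f(S)` has a finite expectation, and the upper bound holds
      (∫⁻ ω, ENNReal.ofReal (-f (∑ i, X i ω)) ∂P < ⊤) ∧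
      erealExpectation P (fun ω => f (∑ i, X i ω)) ≤
        erealExpectation (gaussianReal 0 1) f + thirdDerivInfty f / 6 * (β : EReal)) ∧
    -- the upper bound is the supremum
    IsLUB (expectationValues.{u} β f)
      (erealExpectation (gaussianReal 0 1) f + thirdDerivInfty f / 6 * (β : EReal)) := by
  have hZ : ∫⁻ z, ENNReal.ofReal (-f z) ∂(gaussianReal 0 1) < ⊤ :=
    hf.lintegral_neg_lt_top (HasMoments.gaussianReal 1).integrable_id
  have hneg : ∀ (n : ℕ) (Ω : Type u) [MeasurableSpace Ω] (P : Measure Ω) [IsProbabilityMeasure P]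
      (X : Fin n → Ω → ℝ), MomentConditions P β X →
      ∫⁻ ω, ENNReal.ofReal (-f (∑ i, X i ω)) ∂P < ⊤ := fun n Ω _ P _ X hX =>
    hf.lintegral_neg_lt_top
      (integrable_finsetSum _ fun i _ => (hX.memLp_two i).integrable (by norm_num))
  have hlim := hf.tendsto_thirdDeriv
  suffices hub : (∀ (n : ℕ) (Ω : Type u) [MeasurableSpace Ω] (P : Measure Ω)
      [IsProbabilityMeasure P] (X : Fin n → Ω → ℝ), MomentConditions P β X →
      erealExpectation P (fun ω => f (∑ i, X i ω)) ≤
        erealExpectation (gaussianReal 0 1) f + thirdDerivInfty f / 6 * (β : EReal)) ∧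
      ∀ c ∈ upperBounds (expectationValues.{u} β f),
        erealExpectation (gaussianReal 0 1) f + thirdDerivInfty f / 6 * (β : EReal) ≤ c by
    refine ⟨hZ, fun n Ω _ P _ X hX => ⟨hneg n Ω P X hX, hub.1 n Ω P X hX⟩, ?_, hub.2⟩
    rintro e ⟨n, Ω, _, P, _, X, hX, rfl⟩
    exact hub.1 n Ω P X hX
  rcases eq_or_ne (thirdDerivInfty f) ⊤ with htop | htop
  · -- The right-hand side is infinite.
    rw [htop, EReal.top_div_of_pos_ne_top (by norm_num) (by exact EReal.coe_ne_top 6),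
      EReal.top_mul_coe_of_pos hβ, EReal.add_top_of_ne_bot (erealExpectation_ne_bot hZ)]
    refine ⟨fun _ _ _ _ _ _ _ => le_top, fun c hc => ?_⟩
    rw [htop] at hlim
    have h := tendsto_atTop_add_const_left _ (f 0)
      (((EReal.tendsto_coe_nhds_top_iff.1 hlim).atTop_div_const
        (show (0 : ℝ) < 6 by norm_num)).atTop_mul_const hβ)
    exact le_of_tendsto' (EReal.tendsto_coe_nhds_top_iff.2 h)
      fun y => le_of_upperBounds_single hβ hf hc y
  · obtain ⟨L, hL⟩ : ∃ L : ℝ, thirdDerivInfty f = L :=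
      ⟨_, (EReal.coe_toReal htop
        (ne_bot_of_le_ne_bot (by simp) hf.thirdDerivInfty_nonneg)).symm⟩
    have hL0 : 0 ≤ L := EReal.coe_nonneg.1 (hL ▸ hf.thirdDerivInfty_nonneg)
    rw [hL, EReal.tendsto_coe] at hlim
    have hle (x : ℝ) : thirdDeriv f x ≤ L := hf.monotone_thirdDeriv.ge_of_tendsto hlim x
    have hrhs : erealExpectation (gaussianReal 0 1) f + thirdDerivInfty f / 6 * (β : EReal) =
        ((∫ z, f z ∂(gaussianReal 0 1) + L / 6 * β : ℝ) : EReal) := by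
      rw [erealExpectation_eq_integral (hf.integrable hle (.gaussianReal 1)), hL]
      push_cast [EReal.coe_div]
      rfl
    rw [hrhs]
    refine ⟨fun n Ω _ P _ X hX => ?_, fun c hc => ?_⟩
    · obtain ⟨hi, hb⟩ := hf.integral_sum_le hL0 hle hX
      rw [erealExpectation_eq_integral hi]
      exact EReal.coe_le_coe_iff.2 hb
    · exact le_of_tendsto' (EReal.tendsto_coe.2
        (((hlim.div_const 6).mul_const β).const_add (∫ z, f z ∂(gaussianReal 0 1))))
        fun y => le_of_upperBounds_gaussian hβ hf hle hc y
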